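/- Encode a string $w = w_1\cdots w_n \in \{0,1\}^n$ ($n \ge 1$) as the first-order structure with universe $\{1,\dots,n\}$ over the vocabulary $\langle <, S;\ \mathsf{min},\mathsf{max}\rangle$, where $<$ is the usual order, $S=\{i : w_i = 1\}$, $\mathsf{min}=1$ and $\mathsf{max}=n$; first-order formulas may use equality. A sentence separates $w$ from all other $n$-bit strings if it is true in $w$ and false in every $w'\in\{0,1\}^n$ with $w'\neq w$. Let $\log$ denote the base-2 logarithm. For every $\varepsilon>0$ there is a constant $C_\varepsilon$, depending only on $\varepsilon$, such that for every $n\ge 1$ and every $w\in\{0,1\}^n$ there is a first-order sentence $\varphi$ with at most $(1+\varepsilon)\log n + C_\varepsilon$ quantifiers that separates $w$ from all other $n$-bit strings. Moreover, $\varphi$ can be taken in prenex form with a quantifier prefix consisting of one $\forall$, followed by at most $\varepsilon\log n + 1$ occurrences of $\exists$, followed by a strictly alternating block of quantifiers of length at most $\log n + C_\varepsilon$. -/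

import Mathlib

open FirstOrder

namespace BitString

/-- Function symbols of the vocabulary of binary strings: two constants. -/
inductive Func : ℕ → Type
  | min : Func 0
  | max : Func 0

/-- Relation symbols of the vocabulary of binary strings: the binary order symbol `<`
and the unary symbol `S` (the bit is one). -/
inductive Rel : ℕ → Type
  | lt : Rel 2
  | one : Rel 1

/-- The vocabulary `⟨<, S ; min, max⟩` of binary strings. -/
def lang : FirstOrder.Language.{0, 0} := ⟨Func, Rel⟩

/-- The universe of the structure encoding an `n`-bit string `w`: its set of positions
(numbered from `0`). -/
def Pos {n : ℕ} (_w : Fin n → Bool) : Type := Fin n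

/-- The structure encoding a nonempty string `w`: `<` is the order of the positions, `S` is the
set of positions holding the bit one, `min` and `max` are the first and the last position. -/
instance structurePos {n : ℕ} [NeZero n] (w : Fin n → Bool) : lang.Structure (Pos w) where
  funMap {k} f _ :=
    match k, f with
    | _, Func.min => (⟨0, Nat.pos_of_neZero n⟩ : Fin n)
    | _, Func.max => (⟨n - 1, Nat.sub_lt (Nat.pos_of_neZero n) Nat.one_pos⟩ : Fin n)
  RelMap {k} r :=
    match k, r with
    | _, Rel.lt => fun x => @LT.lt (Fin n) _ (x 0) (x 1)
    | _, Rel.one => fun x => w (x 0) = true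

/-- The sentence `φ` separates `A` from `B`: it holds in every string of `A` and fails in every
string of `B`. -/
def Separates {n : ℕ} [NeZero n] (φ : lang.Sentence) (A B : Set (Fin n → Bool)) : Prop :=
  (∀ w ∈ A, Pos w ⊨ φ) ∧ ∀ w ∈ B, ¬ Pos w ⊨ φ

end BitString

/-- The two first-order quantifiers. -/
inductive Quantifier
  | all
  | ex

/-- The number of quantifiers occurring in a first-order formula. An existential quantifier is
`¬∀¬`, so each quantifier, universal or existential, contributes exactly one `all`. -/
def quantifierNumber {L : FirstOrder.Language.{0, 0}} {α : Type} : {m : ℕ} → L.BoundedFormula α m → ℕ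
  | _, .falsum => 0
  | _, .equal _ _ => 0
  | _, .rel _ _ => 0
  | _, .imp φ ψ => quantifierNumber φ + quantifierNumber ψ
  | _, .all φ => quantifierNumber φ + 1

/-- `HasPrefix p φ`: the formula `φ` is in prenex form, with a quantifier-free matrix and with
quantifier prefix `p` (outermost quantifier first). -/
inductive HasPrefix {L : FirstOrder.Language.{0, 0}} {α : Type} :
    {m : ℕ} → List Quantifier → L.BoundedFormula α m → Prop
  | qf {m : ℕ} {φ : L.BoundedFormula α m} : φ.IsQF → HasPrefix [] φ
  | all {m : ℕ} {p : List Quantifier} {φ : L.BoundedFormula α (m + 1)} :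
      HasPrefix p φ → HasPrefix (Quantifier.all :: p) φ.all
  | ex {m : ℕ} {p : List Quantifier} {φ : L.BoundedFormula α (m + 1)} :
      HasPrefix p φ → HasPrefix (Quantifier.ex :: p) φ.ex

/-- Strict alternation: any two consecutive quantifiers differ. -/
def Alternating (p : List Quantifier) : Prop := List.IsChain (fun a b => a ≠ b) p

/-! The sentence says that every position x is some i whose bit in w is the bit at x. Prenex tests
for x = i cannot simply share universal quantifiers in a disjunction over i, so i is announced
beforehand: existential variables y spell a code word of i in letters z, which are pairwise distinct
positions. The resulting quantifier-free guards exclude each other, and the disjunction then costs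
no quantifier (`exists_exclusive`). Words of length about ε log n over an alphabet of bounded size
suffice (`exists_injective_code`).

The test for x = i asks for a gap of at least i before x and at least n - 1 - i after it. One
quantified position lies in only one of the two intervals, so each alternating quantifier roughly
halves both bounds (`prefixDefinable_gaps`), and log n + O(1) of them suffice. -/

namespace BitString

open FirstOrder.Language

variable {n : ℕ} [NeZero n]

/-! ### Semantic definability by prefix -/

/-- A property of a string together with `m` marked positions. -/
abbrev Property (n m : ℕ) : Type := (Fin n → Bool) → (Fin m → Fin n) → Prop

/-- The formula is true in the string under an assignment of positions to its variables. -/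
def Holds {m : ℕ} (φ : lang.BoundedFormula Empty m) : Property n m := fun w v =>
  φ.Realize (M := Pos w) default (fun i => (v i : Pos w))

section Holds

variable {m : ℕ} (w : Fin n → Bool) (v : Fin m → Fin n)

theorem holds_not {φ : lang.BoundedFormula Empty m} : Holds φ.not w v ↔ ¬ Holds φ w v :=
  BoundedFormula.realize_not

theorem holds_inf {φ ψ : lang.BoundedFormula Empty m} :
    Holds (φ ⊓ ψ) w v ↔ Holds φ w v ∧ Holds ψ w v :=
  BoundedFormula.realize_inf

theorem holds_imp {φ ψ : lang.BoundedFormula Empty m} :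
    Holds (φ.imp ψ) w v ↔ (Holds φ w v → Holds ψ w v) :=
  Iff.rfl

theorem not_holds_bot : ¬ Holds (⊥ : lang.BoundedFormula Empty m) w v := id

theorem holds_top : Holds (⊤ : lang.BoundedFormula Empty m) w v := id

theorem holds_all {φ : lang.BoundedFormula Empty (m + 1)} :
    Holds φ.all w v ↔ ∀ e : Fin n, Holds φ w (Fin.snoc (α := fun _ => Fin n) v e) :=
  Iff.rfl

theorem holds_ex {φ : lang.BoundedFormula Empty (m + 1)} :
    Holds φ.ex w v ↔ ∃ e : Fin n, Holds φ w (Fin.snoc (α := fun _ => Fin n) v e) :=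
  BoundedFormula.realize_ex

end Holds

/-- The property is expressed by a quantifier-free formula. -/
def QFDefinable {m : ℕ} (P : Property n m) : Prop :=
  ∃ φ : lang.BoundedFormula Empty m, φ.IsQF ∧ ∀ w v, Holds φ w v ↔ P w v

/-- The property is expressed by a prenex formula with the given quantifier prefix. -/
def PrefixDefinable : List Quantifier → (m : ℕ) → Property n m → Prop
  | [], _, P => QFDefinable P
  | .all :: p, m, P => ∃ Q : Property n (m + 1), PrefixDefinable p (m + 1) Q ∧
      ∀ w v, P w v ↔ ∀ e : Fin n, Q w (Fin.snoc (α := fun _ => Fin n) v e)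
  | .ex :: p, m, P => ∃ Q : Property n (m + 1), PrefixDefinable p (m + 1) Q ∧
      ∀ w v, P w v ↔ ∃ e : Fin n, Q w (Fin.snoc (α := fun _ => Fin n) v e)

namespace QFDefinable

variable {m : ℕ} {P Q : Property n m}

theorem congr (hP : QFDefinable P) (h : ∀ w v, P w v ↔ Q w v) : QFDefinable Q := by
  obtain ⟨φ, hφ, hr⟩ := hP
  exact ⟨φ, hφ, fun w v => (hr w v).trans (h w v)⟩

theorem const (c : Prop) : QFDefinable (fun _ _ => c : Property n m) := by
  by_cases hc : c
  · exact ⟨⊤, BoundedFormula.IsQF.top, fun w v => iff_of_true (holds_top w v) hc⟩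
  · exact ⟨⊥, BoundedFormula.isQF_bot, fun w v => iff_of_false (not_holds_bot w v) hc⟩

theorem not (hP : QFDefinable P) : QFDefinable (fun w v => ¬ P w v) := by
  obtain ⟨φ, hφ, hr⟩ := hP
  exact ⟨φ.not, hφ.not, fun w v => by rw [holds_not, hr]⟩

theorem and (hP : QFDefinable P) (hQ : QFDefinable Q) :
    QFDefinable (fun w v => P w v ∧ Q w v) := by
  obtain ⟨φ, hφ, hr⟩ := hP
  obtain ⟨ψ, hψ, hs⟩ := hQ
  exact ⟨φ ⊓ ψ, hφ.inf hψ, fun w v => by rw [holds_inf, hr, hs]⟩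

theorem or (hP : QFDefinable P) (hQ : QFDefinable Q) :
    QFDefinable (fun w v => P w v ∨ Q w v) :=
  (hP.not.and hQ.not).not.congr fun w v => by tauto

theorem forall_finite {ι : Type*} [Finite ι] {P : ι → Property n m}
    (hP : ∀ i, QFDefinable (P i)) : QFDefinable (fun w v => ∀ i, P i w v) := by
  classical
  have := Fintype.ofFinite ι
  suffices h : ∀ s : Finset ι, QFDefinable (fun w v => ∀ i ∈ s, P i w v) from
    (h Finset.univ).congr fun w v => by simp
  intro s
  induction s using Finset.induction_on with
  | empty => exact (const True).congr fun w v => by simp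
  | insert a s _ ih => exact ((hP a).and ih).congr fun w v => by simp

theorem rename {k : ℕ} (f : Fin m → Fin k) (hP : QFDefinable P) :
    QFDefinable (fun w v => P w (v ∘ f) : Property n k) := by
  obtain ⟨φ, hφ, hr⟩ := hP
  suffices h : ∃ ψ : lang.BoundedFormula Empty k, ψ.IsQF ∧
      ∀ (w : Fin n → Bool) (v : Fin k → Fin n), Holds ψ w v ↔ Holds φ w (v ∘ f) by
    obtain ⟨ψ, hψ, hs⟩ := h
    exact ⟨ψ, hψ, fun w v => (hs w v).trans (hr w _)⟩
  clear hr
  have hterm : ∀ (t : lang.Term (Empty ⊕ Fin m)) (w : Fin n → Bool) (v : Fin k → Fin n),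
      (t.relabel (Sum.map id f)).realize (M := Pos w)
          (Sum.elim default (fun i => (v i : Pos w))) =
        t.realize (M := Pos w) (Sum.elim default (fun i => ((v ∘ f) i : Pos w))) := by
    intro t w v
    rw [Term.realize_relabel]
    congr 1
    funext x
    cases x <;> rfl
  induction hφ with
  | falsum => exact ⟨⊥, BoundedFormula.isQF_bot, fun w v => Iff.rfl⟩
  | of_isAtomic h =>
    cases h with
    | equal t₁ t₂ =>
      refine ⟨(t₁.relabel (Sum.map id f)).bdEqual (t₂.relabel (Sum.map id f)),
        (BoundedFormula.IsAtomic.equal _ _).isQF, fun w v => ?_⟩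
      exact BoundedFormula.realize_bdEqual _ _ |>.trans
        (by rw [hterm, hterm]) |>.trans (BoundedFormula.realize_bdEqual _ _).symm
    | rel R ts =>
      refine ⟨R.boundedFormula fun i => (ts i).relabel (Sum.map id f),
        (BoundedFormula.IsAtomic.rel _ _).isQF, fun w v => ?_⟩
      exact BoundedFormula.realize_rel.trans
        (by simp only [hterm]) |>.trans BoundedFormula.realize_rel.symm
  | imp _ _ ih₁ ih₂ =>
    obtain ⟨ψ₁, h₁, hr₁⟩ := ih₁
    obtain ⟨ψ₂, h₂, hr₂⟩ := ih₂
    exact ⟨ψ₁.imp ψ₂, h₁.imp h₂, fun w v => by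
      rw [holds_imp, holds_imp, hr₁, hr₂]⟩

end QFDefinable

/-! ### Atomic conditions on positions -/

/-- A position named by a variable or by one of the two constants. -/
inductive Point (m : ℕ) : Type
  | var (i : Fin m)
  | first
  | last

/-- The position that a point names under an assignment. -/
def Point.eval {m : ℕ} (v : Fin m → Fin n) : Point m → Fin n
  | .var i => v i
  | .first => ⟨0, Nat.pos_of_neZero n⟩
  | .last => ⟨n - 1, Nat.sub_lt (Nat.pos_of_neZero n) Nat.one_pos⟩

@[simp]
theorem Point.eval_var {m : ℕ} (v : Fin m → Fin n) (i : Fin m) : (Point.var i).eval v = v i := rfl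

/-- The term denoting a point. -/
def Point.term {m : ℕ} : Point m → lang.Term (Empty ⊕ Fin m)
  | .var i => Term.var (Sum.inr i)
  | .first => Term.func (L := lang) (Func.min : lang.Functions 0) Fin.elim0
  | .last => Term.func (L := lang) (Func.max : lang.Functions 0) Fin.elim0

theorem Point.realize_term {m : ℕ} (a : Point m) (w : Fin n → Bool) (v : Fin m → Fin n) :
    a.term.realize (M := Pos w) (Sum.elim default (fun i => (v i : Pos w))) =
      (a.eval v : Pos w) := by
  cases a <;> rfl

/-- The same point, seen after a further variable has been quantified. -/
def Point.weaken {m : ℕ} : Point m → Point (m + 1)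
  | .var i => .var i.castSucc
  | .first => .first
  | .last => .last

@[simp]
theorem Point.eval_weaken {m : ℕ} (a : Point m) (v : Fin m → Fin n) (e : Fin n) :
    a.weaken.eval (Fin.snoc (α := fun _ => Fin n) v e) = a.eval v := by
  cases a <;> simp [Point.weaken, Point.eval]

namespace QFDefinable

variable {m : ℕ}

theorem lt (a b : Point m) : QFDefinable (fun _ v => a.eval v < b.eval v : Property n m) :=
  ⟨Relations.boundedFormula₂ (L := lang) (Rel.lt : lang.Relations 2) a.term b.term,
    (BoundedFormula.IsAtomic.rel _ _).isQF, fun w v =>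
      BoundedFormula.realize_rel₂.trans (by rw [a.realize_term, b.realize_term]; rfl)⟩

theorem le (a b : Point m) : QFDefinable (fun _ v => a.eval v ≤ b.eval v : Property n m) :=
  (lt b a).not.congr fun _ _ => not_lt

theorem eq (i j : Fin m) : QFDefinable (fun _ v => v i = v j : Property n m) :=
  ((le (.var i) (.var j)).and (le (.var j) (.var i))).congr fun _ _ => le_antisymm_iff.symm

theorem bit_eq (i : Fin m) (c : Bool) : QFDefinable (fun w v => w (v i) = c : Property n m) := by
  have h : QFDefinable (fun w v => w (v i) = true : Property n m) :=
    ⟨Relations.boundedFormula₁ (L := lang) (Rel.one : lang.Relations 1) (Point.var i).term,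
      (BoundedFormula.IsAtomic.rel _ _).isQF, fun w v =>
        BoundedFormula.realize_rel₁.trans (by rw [Point.realize_term]; rfl)⟩
  cases c
  · exact h.not.congr fun w v => by simp
  · exact h

end QFDefinable

/-! ### Closure properties of a fixed prefix -/

namespace PrefixDefinable

variable {m : ℕ} {p : List Quantifier} {P Q : Property n m}

theorem congr (hP : PrefixDefinable p m P) (h : ∀ w v, P w v ↔ Q w v) :
    PrefixDefinable p m Q := by
  have : P = Q := by funext w v; exact propext (h w v)
  exact this ▸ hP

theorem forall_snoc {Q : Property n (m + 1)} (hQ : PrefixDefinable p (m + 1) Q) :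
    PrefixDefinable (.all :: p) m
      (fun w v => ∀ e : Fin n, Q w (Fin.snoc (α := fun _ => Fin n) v e)) :=
  ⟨Q, hQ, fun _ _ => Iff.rfl⟩

theorem exists_snoc {Q : Property n (m + 1)} (hQ : PrefixDefinable p (m + 1) Q) :
    PrefixDefinable (.ex :: p) m
      (fun w v => ∃ e : Fin n, Q w (Fin.snoc (α := fun _ => Fin n) v e)) :=
  ⟨Q, hQ, fun _ _ => Iff.rfl⟩

theorem rename {k : ℕ} (f : Fin m → Fin k) (hP : PrefixDefinable p m P) :
    PrefixDefinable p k (fun w v => P w (v ∘ f)) := by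
  induction p generalizing m k with
  | nil => exact QFDefinable.rename f hP
  | cons q p ih =>
    have key : ∀ (v : Fin k → Fin n) (e : Fin n),
        Fin.snoc (α := fun _ => Fin n) v e ∘
          Fin.snoc (α := fun _ => Fin (k + 1)) (fun i => (f i).castSucc) (Fin.last k) =
          Fin.snoc (α := fun _ => Fin n) (v ∘ f) e := by
      intro v e
      funext i
      refine Fin.lastCases ?_ (fun i => ?_) i <;> simp
    cases q <;>
    · obtain ⟨Q, hQ, h⟩ := hP
      refine ⟨_, ih (Fin.snoc (α := fun _ => Fin (k + 1)) (fun i => (f i).castSucc)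
        (Fin.last k)) hQ, fun w v => ?_⟩
      simp only [h, key]

theorem weaken (hP : PrefixDefinable p m P) :
    PrefixDefinable p (m + 1) (fun w v => P w (v ∘ Fin.castSucc)) :=
  hP.rename _

/-- Dummy quantifiers are harmless because the universe is nonempty. -/
theorem of_qf (hP : QFDefinable P) : PrefixDefinable p m P := by
  induction p generalizing m with
  | nil => exact hP
  | cons q p ih =>
    have := NeZero.pos n
    cases q <;>
    · refine ⟨_, ih (hP.rename Fin.castSucc), fun w v => ?_⟩
      have h : ∀ e : Fin n, Fin.snoc (α := fun _ => Fin n) v e ∘ Fin.castSucc = v := fun e => by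
        funext i; simp
      simp [h]

/-- Case distinction on a quantifier-free condition does not change the prefix. -/
theorem ite {G : Property n m} (hG : QFDefinable G) (hP : PrefixDefinable p m P)
    (hQ : PrefixDefinable p m Q) :
    PrefixDefinable p m (fun w v => G w v ∧ P w v ∨ ¬ G w v ∧ Q w v) := by
  induction p generalizing m with
  | nil => exact (hG.and hP).or (hG.not.and hQ)
  | cons q p ih =>
    have := NeZero.pos n
    cases q <;>
    · obtain ⟨P', hP', h⟩ := hP
      obtain ⟨Q', hQ', h'⟩ := hQ
      refine ⟨_, ih (hG.rename Fin.castSucc) hP' hQ', fun w v => ?_⟩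
      have h₀ : ∀ e : Fin n, Fin.snoc (α := fun _ => Fin n) v e ∘ Fin.castSucc = v := fun e => by
        funext i; simp
      simp only [h, h', h₀]
      by_cases hg : G w v <;> simp [hg]

theorem and_qf {G : Property n m} (hG : QFDefinable G) (hP : PrefixDefinable p m P) :
    PrefixDefinable p m (fun w v => G w v ∧ P w v) :=
  (ite hG hP (of_qf (QFDefinable.const False))).congr fun w v => by tauto

/-- A disjunction over mutually exclusive quantifier-free conditions does not change the prefix. -/
theorem exists_exclusive {ι : Type*} [Finite ι] {G P : ι → Property n m}
    (hG : ∀ i, QFDefinable (G i)) (hP : ∀ i, PrefixDefinable p m (P i))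
    (hex : ∀ i j w v, G i w v → G j w v → i = j) :
    PrefixDefinable p m (fun w v => ∃ i, G i w v ∧ P i w v) := by
  classical
  have := Fintype.ofFinite ι
  suffices h : ∀ s : Finset ι, PrefixDefinable p m (fun w v => ∃ i ∈ s, G i w v ∧ P i w v) from
    (h Finset.univ).congr fun w v => by simp
  intro s
  induction s using Finset.induction_on with
  | empty => exact (of_qf (QFDefinable.const False)).congr fun w v => by simp
  | insert a s ha ih =>
    refine (ite (hG a) (hP a) ih).congr fun w v => ?_
    simp only [Finset.exists_mem_insert]
    by_cases hg : G a w v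
    · simp only [hg, true_and, not_true_eq_false, false_and, or_false, iff_self_or]
      rintro ⟨i, -, hi, hPi⟩
      exact hex _ _ _ _ hi hg ▸ hPi
    · simp [hg]

/-- Several existential quantifiers, each of them followed by quantifiers over dummy variables. -/
theorem exists_append (q : List Quantifier)
    (hq : ∀ (p : List Quantifier) (m : ℕ) (Q : Property n (m + 1)), PrefixDefinable p (m + 1) Q →
      PrefixDefinable (q ++ p) m
        (fun w v => ∃ e : Fin n, Q w (Fin.snoc (α := fun _ => Fin n) v e)))
    (k : ℕ) {Q : Property n (m + k)} (hQ : PrefixDefinable p (m + k) Q) :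
    PrefixDefinable ((List.replicate k q).flatten ++ p) m
      (fun w v => ∃ y : Fin k → Fin n, Q w (Fin.append v y)) := by
  induction k generalizing p with
  | zero =>
    refine PrefixDefinable.congr (P := Q) (by simpa using hQ) fun w v => ?_
    have h : ∀ y : Fin 0 → Fin n, Fin.append v y = v := fun y => by
      rw [Subsingleton.elim y Fin.elim0, Fin.append_elim0]; rfl
    simp [h]
  | succ k ih =>
    have h := ih (hq p (m + k) Q hQ)
    rw [← List.append_assoc, ← List.flatten_concat, ← List.replicate_succ'] at h
    refine h.congr fun w v => ?_
    constructor
    · rintro ⟨y, e, h⟩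
      refine ⟨Fin.snoc (α := fun _ => Fin n) y e, ?_⟩
      rwa [Fin.append_snoc]
    · rintro ⟨y, h⟩
      refine ⟨Fin.init y, y (Fin.last k), ?_⟩
      rwa [← Fin.append_snoc, Fin.snoc_init_self]

theorem exists_hasPrefix (hP : PrefixDefinable p m P) :
    ∃ φ : lang.BoundedFormula Empty m, HasPrefix p φ ∧ ∀ w v, Holds φ w v ↔ P w v := by
  induction p generalizing m with
  | nil =>
    obtain ⟨φ, hφ, h⟩ := hP
    exact ⟨φ, .qf hφ, h⟩
  | cons q p ih =>
    cases q
    · obtain ⟨Q, hQ, h⟩ := hP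
      obtain ⟨φ, hφ, hr⟩ := ih hQ
      refine ⟨φ.all, .all hφ, fun w v => ?_⟩
      rw [h, holds_all]
      exact forall_congr' fun e => hr w _
    · obtain ⟨Q, hQ, h⟩ := hP
      obtain ⟨φ, hφ, hr⟩ := ih hQ
      refine ⟨φ.ex, .ex hφ, fun w v => ?_⟩
      rw [h, holds_ex]
      exact exists_congr fun e => hr w _

end PrefixDefinable

end BitString

/-! ### Counting quantifiers; alternating prefixes -/

theorem quantifierNumber_of_isQF {L : FirstOrder.Language.{0, 0}} {α : Type} {m : ℕ}
    {φ : L.BoundedFormula α m} (h : φ.IsQF) : quantifierNumber φ = 0 := by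
  induction h with
  | falsum => rfl
  | of_isAtomic h => cases h <;> rfl
  | imp _ _ h₁ h₂ => simp [quantifierNumber, h₁, h₂]

theorem HasPrefix.quantifierNumber_eq {L : FirstOrder.Language.{0, 0}} {α : Type} {m : ℕ}
    {p : List Quantifier} {φ : L.BoundedFormula α m} (h : HasPrefix p φ) :
    quantifierNumber φ = p.length := by
  induction h with
  | qf h => exact quantifierNumber_of_isQF h
  | all _ ih => simp [quantifierNumber, ih]
  | ex _ ih =>
    simpa [quantifierNumber] using ih

/-- The other quantifier. -/
def Quantifier.dual : Quantifier → Quantifier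
  | .all => .ex
  | .ex => .all

/-- The strictly alternating list of a given length with a given first entry. -/
def alternatingList : Quantifier → ℕ → List Quantifier
  | _, 0 => []
  | q, r + 1 => q :: alternatingList q.dual r

theorem length_alternatingList (q : Quantifier) (r : ℕ) : (alternatingList q r).length = r := by
  induction r generalizing q with
  | zero => rfl
  | succ r ih => simp [alternatingList, ih]

theorem alternating_alternatingList (q : Quantifier) (r : ℕ) :
    Alternating (alternatingList q r) := by
  induction r generalizing q with
  | zero => exact List.IsChain.nil
  | succ r ih =>
    have h := ih q.dual
    cases r with
    | zero => exact List.IsChain.singleton q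
    | succ r => exact List.IsChain.cons_cons (by cases q <;> simp [Quantifier.dual]) h

theorem flatten_replicate_append_alternatingList (b r : ℕ) :
    (List.replicate b [Quantifier.ex, Quantifier.all]).flatten ++ alternatingList .ex r =
      alternatingList .ex (2 * b + r) := by
  induction b with
  | zero => simp
  | succ b ih =>
    rw [List.replicate_succ, List.flatten_cons, List.append_assoc, ih,
      show 2 * (b + 1) + r = 2 * b + r + 1 + 1 by ring]
    rfl

/-! ### Halving two gaps at once -/

/-- A gap is long iff each of its points is far from one end. The first interval is half-open so
that `e = m` belongs to the second only; the case `a = m`, where it is empty, needs the extra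
clause. -/
theorem gap_and_gap_iff {n a m b s t : ℕ} (hb : b < n) (ham : a ≤ m) (hmb : m ≤ b) :
    a + s ≤ m ∧ m + t ≤ b ↔ (s = 0 ∨ a < m) ∧ ∀ e : Fin n,
      (a ≤ e ∧ (e : ℕ) < m → a + (s + 1) / 2 ≤ e ∨ e + (s + 2) / 2 ≤ m) ∧
      (m ≤ e ∧ (e : ℕ) ≤ b → m + (t + 1) / 2 ≤ e ∨ e + (t + 2) / 2 ≤ b) := by
  constructor
  · rintro ⟨h₁, h₂⟩
    refine ⟨by omega, fun e => ⟨fun h => ?_, fun h => ?_⟩⟩ <;> omega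
  · rintro ⟨h₀, h⟩
    constructor
    · by_contra hs
      -- The last point too close to `a`, cut off at the end of the interval.
      have := (h ⟨a + min ((s + 1) / 2 - 1) (m - 1 - a), by omega⟩).1
      simp only at this
      omega
    · by_contra ht
      have := (h ⟨m + min ((t + 1) / 2 - 1) (b - m), by omega⟩).2
      simp only at this
      omega

/-- A midpoint witnesses a long gap. As `t ≠ 0`, the midpoint of the right gap lies strictly beyond
`m`, so its place tells which gap it witnesses. -/
theorem gap_or_gap_iff {n a m b s t : ℕ} (hb : b < n) (ham : a ≤ m) (hmb : m ≤ b) (ht : t ≠ 0) :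
    a + s ≤ m ∨ m + t ≤ b ↔ ∃ e : Fin n,
      (a ≤ e ∧ (e : ℕ) ≤ m ∧ a + s / 2 ≤ e ∧ e + (s + 1) / 2 ≤ m) ∨
      (m < e ∧ (e : ℕ) ≤ b ∧ m + (t + 1) / 2 ≤ e ∧ e + t / 2 ≤ b) := by
  constructor
  · rintro (h | h)
    · exact ⟨⟨a + s / 2, by omega⟩, Or.inl (by simp only; omega)⟩
    · exact ⟨⟨m + (t + 1) / 2, by omega⟩, Or.inr (by simp only; omega)⟩
  · rintro ⟨e, h⟩
    omega

namespace BitString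

variable {n : ℕ} [NeZero n]

/-- The thresholds that alternating prefixes of a given length can handle. -/
def capacity : Quantifier → ℕ → ℕ
  | _, 0 => 1
  | .all, r + 1 => 2 * capacity .ex r - 1
  | .ex, r + 1 => 2 * capacity .all r

theorem capacity_pos (q : Quantifier) (r : ℕ) : 0 < capacity q r := by
  induction r generalizing q with
  | zero => exact one_pos
  | succ r ih =>
    have h₁ := ih .all
    have h₂ := ih .ex
    cases q <;> simp only [capacity] <;> omega

/-- Strictness absorbs the `- 1` lost at each universal quantifier; two initial quantifiers provide
it. -/
theorem two_pow_lt_capacity (q : Quantifier) (r : ℕ) : 2 ^ r < capacity q (r + 2) := by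
  induction r generalizing q with
  | zero => cases q <;> simp [capacity]
  | succ r ih =>
    have h₁ := ih .all
    have h₂ := ih .ex
    rw [pow_succ]
    cases q
    · rw [show capacity .all (r + 1 + 2) = 2 * capacity .ex (r + 2) - 1 from rfl]; omega
    · rw [show capacity .ex (r + 1 + 2) = 2 * capacity .all (r + 2) from rfl]; omega

/-- Lower bounds on the lengths of two adjacent intervals: one alternating quantifier halves the
bounds, since it can be used in both intervals at the same time. -/
theorem prefixDefinable_gaps (r : ℕ) :
    (∀ (k : ℕ) (a m b : Point k) (s t : ℕ), s ≤ capacity .all r → t ≤ capacity .all r →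
      PrefixDefinable (alternatingList .all r) k (fun _ v => a.eval v ≤ m.eval v ∧
        m.eval v ≤ b.eval v ∧ (a.eval v : ℕ) + s ≤ m.eval v ∧ (m.eval v : ℕ) + t ≤ b.eval v :
          Property n k)) ∧
    (∀ (k : ℕ) (a m b : Point k) (s t : ℕ), s ≤ capacity .ex r → t ≤ capacity .ex r → t ≠ 0 →
      PrefixDefinable (alternatingList .ex r) k (fun _ v => a.eval v ≤ m.eval v ∧
        m.eval v ≤ b.eval v ∧ ((a.eval v : ℕ) + s ≤ m.eval v ∨ (m.eval v : ℕ) + t ≤ b.eval v) :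
          Property n k)) := by
  induction r with
  | zero =>
    have base : ∀ (k : ℕ) (a m : Point k) (s : ℕ), s ≤ 1 → QFDefinable (fun _ v =>
        (a.eval v ≤ m.eval v ∧ (s = 0 ∨ a.eval v < m.eval v)) : Property n k) := fun k a m s _ =>
      (QFDefinable.le a m).and ((QFDefinable.const _).or (QFDefinable.lt a m))
    refine ⟨fun k a m b s t hs ht => ?_, fun k a m b s t hs ht _ => ?_⟩ <;>
      simp only [capacity] at hs ht
    · refine ((base k a m s hs).and (base k m b t ht)).congr fun w v => ?_
      simp only [Fin.le_def, Fin.lt_def]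
      omega
    · refine ((QFDefinable.le a m).and ((QFDefinable.le m b).and
        ((base k a m s hs).or (base k m b t ht)))).congr fun w v => ?_
      simp only [Fin.le_def, Fin.lt_def]
      omega
  | succ r ih =>
    obtain ⟨ihA, ihE⟩ := ih
    refine ⟨fun k a m b s t hs ht => ?_, fun k a m b s t hs ht ht₀ => ?_⟩ <;>
      simp only [capacity] at hs ht
    · have hpos := capacity_pos .ex r
      -- `e` now separates two shorter gaps, one of which must be long. The second bound is
      -- positive, as the existential case requires.
      have hL := ihE (k + 1) a.weaken (.var (Fin.last k)) m.weaken ((s + 1) / 2) ((s + 2) / 2)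
        (by omega) (by omega) (by omega)
      have hR := ihE (k + 1) m.weaken (.var (Fin.last k)) b.weaken ((t + 1) / 2) ((t + 2) / 2)
        (by omega) (by omega) (by omega)
      have hT : PrefixDefinable (alternatingList .ex r) (k + 1) (fun _ _ => True : Property n _) :=
        .of_qf (.const True)
      have hG : QFDefinable (fun _ v => a.weaken.eval v ≤ (Point.var (Fin.last k)).eval v ∧
          (Point.var (Fin.last k)).eval v < m.weaken.eval v : Property n (k + 1)) :=
        (QFDefinable.le _ _).and (QFDefinable.lt _ _)
      have hG' : QFDefinable (fun _ v => m.weaken.eval v ≤ (Point.var (Fin.last k)).eval v ∧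
          (Point.var (Fin.last k)).eval v ≤ b.weaken.eval v : Property n (k + 1)) :=
        (QFDefinable.le _ _).and (QFDefinable.le _ _)
      refine (PrefixDefinable.and_qf ((QFDefinable.le a m).and ((QFDefinable.le m b).and
        ((QFDefinable.const (s = 0)).or (QFDefinable.lt a m))))
        (PrefixDefinable.forall_snoc (.ite hG hL (.ite hG' hR hT)))).congr fun w v => ?_
      simp only [Point.eval_weaken, Point.eval_var, Fin.snoc_last, Fin.le_def, Fin.lt_def]
      by_cases ham : (a.eval v : ℕ) ≤ m.eval v
      · by_cases hmb : (m.eval v : ℕ) ≤ b.eval v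
        · simp only [ham, hmb, true_and]
          rw [gap_and_gap_iff (b.eval v).isLt ham hmb]
          refine and_congr_right fun _ => forall_congr' fun e => ?_
          rw [and_true]
          omega
        · simp [hmb]
      · simp [ham]
    · have hL := ihA (k + 1) a.weaken (.var (Fin.last k)) m.weaken (s / 2) ((s + 1) / 2)
        (by omega) (by omega)
      have hR := ihA (k + 1) m.weaken (.var (Fin.last k)) b.weaken ((t + 1) / 2) (t / 2)
        (by omega) (by omega)
      refine (PrefixDefinable.and_qf ((QFDefinable.le a m).and (QFDefinable.le m b))
        (PrefixDefinable.exists_snoc (.ite (QFDefinable.le (.var (Fin.last k)) m.weaken) hL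
          hR))).congr fun w v => ?_
      simp only [Point.eval_weaken, Point.eval_var, Fin.snoc_last, Fin.le_def]
      by_cases ham : (a.eval v : ℕ) ≤ m.eval v
      · by_cases hmb : (m.eval v : ℕ) ≤ b.eval v
        · simp only [ham, hmb, true_and]
          rw [gap_or_gap_iff (b.eval v).isLt ham hmb ht₀]
          refine exists_congr fun e => ?_
          omega
        · simp [hmb]
      · simp [ham]

theorem prefixDefinable_val_eq {k r : ℕ} (hn : n ≤ capacity .all r) (j : Fin k) (i : Fin n) :
    PrefixDefinable (alternatingList .all r) k (fun _ v => v j = i : Property n k) := by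
  refine ((prefixDefinable_gaps r).1 k .first (.var j) .last i (n - 1 - i)
    (by omega) (by omega)).congr fun w v => ?_
  simp only [Point.eval, Fin.le_def, Fin.ext_iff]
  omega

/-! ### The sentence defining a string -/

/-- A prefix defining a string, given a block code of length `k` over an alphabet of size `b` for
its positions. -/
theorem prefixDefinable_eq (w : Fin n → Bool) {k b r : ℕ} (hb : b ≤ n)
    (c : Fin n → Fin k → Fin b) (hc : Function.Injective c) (hr : n ≤ capacity .all r) :
    PrefixDefinable (.all :: (List.replicate k .ex ++ alternatingList .ex (2 * b + (r + 1)))) 0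
      (fun w' _ => w' = w) := by
  -- `x` is the tested position, `y` its code word, `z` the alphabet.
  let x : Fin (0 + 1 + k + b) := Fin.castAdd b (Fin.castAdd k (Fin.last 0))
  let y : Fin k → Fin (0 + 1 + k + b) := fun j => Fin.castAdd b (Fin.natAdd (0 + 1) j)
  let z : Fin b → Fin (0 + 1 + k + b) := Fin.natAdd (0 + 1 + k)
  let G : Fin n → Property n (0 + 1 + k + b) := fun i _ v =>
    (∀ j, v (y j) = v (z (c i j))) ∧ ∀ l l', l = l' ∨ ¬ v (z l) = v (z l')
  have hG : ∀ i, QFDefinable (G i) := fun i =>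
    (QFDefinable.forall_finite fun j => QFDefinable.eq _ _).and
      (QFDefinable.forall_finite fun l => QFDefinable.forall_finite fun l' =>
        (QFDefinable.const _).or (QFDefinable.eq _ _).not)
  have hex : ∀ i j w' v, G i w' v → G j w' v → i = j := by
    rintro i j w' v ⟨h₁, h₂⟩ ⟨h₃, -⟩
    -- Different code words would force two letters to coincide.
    refine hc (funext fun l => (h₂ _ _).resolve_right fun h => h ?_)
    rw [← h₁, ← h₃]
  have h₁ : PrefixDefinable (alternatingList .ex (r + 1)) (0 + 1 + k + b)
      (fun w' v => ∃ i, G i w' v ∧ w' (v x) = w i ∧ v x = i : Property n _) := by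
    refine PrefixDefinable.exists_exclusive hG (fun i => ?_) hex
    have h := (prefixDefinable_val_eq hr x i).and_qf (QFDefinable.bit_eq x (w i))
    -- A dummy `∃` keeps the alternation after the `∀` that follows the last letter.
    refine h.weaken.exists_snoc.congr fun w' v => ?_
    have : ∀ e : Fin n, Fin.snoc (α := fun _ => Fin n) v e ∘ Fin.castSucc = v := fun e => by
      funext i; simp
    have := NeZero.pos n
    simp [*]
  -- A dummy `∀` after each letter puts the letters into the alternating block.
  have h₂ := PrefixDefinable.exists_append [.ex, .all] (fun p m Q hQ => by
    refine hQ.weaken.forall_snoc.exists_snoc.congr fun w' v => exists_congr fun e => ?_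
    have : ∀ (u : Fin (m + 1) → Fin n) (e : Fin n),
        Fin.snoc (α := fun _ => Fin n) u e ∘ Fin.castSucc = u := fun u e => by
      funext i; simp
    have := NeZero.pos n
    simp [*]) b h₁
  have h₃ := PrefixDefinable.exists_append [.ex] (fun p m Q hQ => hQ.exists_snoc) k h₂
  rw [flatten_replicate_append_alternatingList, List.flatten_replicate_singleton] at h₃
  refine h₃.forall_snoc.congr fun w' v => ?_
  simp only [G, x, y, z, Fin.append_left, Fin.append_right, Fin.snoc_last]
  rw [funext_iff]
  refine forall_congr' fun e => ?_
  constructor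
  · rintro ⟨_, _, i, -, h, rfl⟩
    exact h
  · intro h
    -- The letters are the first `b` positions; `b ≤ n` makes room for them.
    refine ⟨fun j => Fin.castLE hb (c e j), Fin.castLE hb, e, ⟨fun j => rfl, fun l l' => ?_⟩, h, rfl⟩
    rw [Fin.castLE_inj]
    exact em _

theorem exists_separates (w : Fin n → Bool) {p : List Quantifier}
    (h : PrefixDefinable p 0 (fun w' _ => w' = w)) :
    ∃ φ : lang.Sentence, Separates φ {w} {w' | w' ≠ w} ∧ HasPrefix p φ := by
  obtain ⟨φ, hφ, hr⟩ := h.exists_hasPrefix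
  have key : ∀ w' : Fin n → Bool, Pos w' ⊨ φ ↔ w' = w := fun w' => by
    rw [← hr w' Fin.elim0]
    unfold Language.Sentence.Realize Language.Formula.Realize Holds
    rw [iff_eq_eq]
    congr 1
  exact ⟨φ, ⟨fun w' hw' => (key w').2 hw', fun w' hw' h' => hw' ((key w').1 h')⟩, hφ⟩

end BitString

/-- Positions have a block code of length `⌊ε log n⌋ + 1` over an alphabet of bounded size. -/
theorem exists_injective_code (ε : ℝ) (hε : 0 < ε) : ∃ B : ℕ, ∀ n : ℕ, n ≠ 0 →
    ∃ b ≤ B, b ≤ n ∧ ∃ c : Fin n → Fin (⌊ε * Real.logb 2 n⌋₊ + 1) → Fin b,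
      Function.Injective c := by
  obtain ⟨B, hB⟩ := exists_nat_ge ((2 : ℝ) ^ (1 / ε))
  -- Short strings may have fewer than `B` positions; then all `n` of them serve as letters.
  refine ⟨B, fun n hn => ⟨min B n, min_le_left _ _, min_le_right _ _, ?_⟩⟩
  suffices h : n ≤ min B n ^ (⌊ε * Real.logb 2 n⌋₊ + 1) by
    obtain ⟨f⟩ : Nonempty (Fin n ↪ (Fin (⌊ε * Real.logb 2 n⌋₊ + 1) → Fin (min B n))) :=
      Function.Embedding.nonempty_of_card_le (by simpa using h)
    exact ⟨f, f.injective⟩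
  rcases le_total n B with h | h
  · rw [min_eq_right h]
    exact Nat.le_self_pow (by omega) n
  · rw [min_eq_left h]
    have hn' : (0 : ℝ) < n := by positivity
    have h₁ : (1 : ℝ) ≤ 2 ^ (1 / ε) := Real.one_le_rpow (by norm_num) (by positivity)
    have h₂ : (n : ℝ) ≤ (B : ℝ) ^ (⌊ε * Real.logb 2 n⌋₊ + 1) := by
      calc (n : ℝ) = ((2 : ℝ) ^ (1 / ε)) ^ (ε * Real.logb 2 n) := by
            rw [← Real.rpow_mul (by norm_num), ← mul_assoc, one_div_mul_cancel hε.ne', one_mul,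
              Real.rpow_logb (by norm_num) (by norm_num) hn']
        _ ≤ ((2 : ℝ) ^ (1 / ε)) ^ ((⌊ε * Real.logb 2 n⌋₊ + 1 : ℕ) : ℝ) :=
            Real.rpow_le_rpow_of_exponent_le h₁ (by
              push_cast; exact (Nat.lt_floor_add_one _).le)
        _ = ((2 : ℝ) ^ (1 / ε)) ^ (⌊ε * Real.logb 2 n⌋₊ + 1) := Real.rpow_natCast _ _
        _ ≤ _ := pow_le_pow_left₀ (by positivity) hB _
    exact_mod_cast h₂

theorem mainTheorem3 (ε : ℝ) (hε : 0 < ε) :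
    ∃ C : ℝ, ∀ (n : ℕ) [NeZero n] (w : Fin n → Bool),
      ∃ φ : BitString.lang.Sentence,
        BitString.Separates φ {w} {w' | w' ≠ w} ∧
        (quantifierNumber φ : ℝ) ≤ (1 + ε) * Real.logb 2 n + C ∧
        ∃ (k : ℕ) (block : List Quantifier),
          HasPrefix (Quantifier.all :: (List.replicate k Quantifier.ex ++ block)) φ ∧
          (k : ℝ) ≤ ε * Real.logb 2 n + 1 ∧
          Alternating block ∧
          (block.length : ℝ) ≤ Real.logb 2 n + C := by
  obtain ⟨B, hB⟩ := exists_injective_code ε hε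
  -- Each letter costs at most two quantifiers. The 6 is the leading `∀`, the rounding of `k`, the
  -- dummy `∃`, and the 3 extra rounds of the gap test.
  refine ⟨2 * B + 6, fun n _ w => ?_⟩
  obtain ⟨b, hbB, hbn, c, hc⟩ := hB n (NeZero.ne n)
  have hcap : n ≤ BitString.capacity .all (Nat.log 2 n + 1 + 2) :=
    (Nat.lt_pow_succ_log_self one_lt_two n).le.trans (BitString.two_pow_lt_capacity _ _).le
  obtain ⟨φ, hφ, hp⟩ :=
    BitString.exists_separates w (BitString.prefixDefinable_eq w hbn c hc hcap)
  have hlog : (Nat.log 2 n : ℝ) ≤ Real.logb 2 n := by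
    exact_mod_cast Real.natLog_le_logb n 2
  have hpos : 0 ≤ ε * Real.logb 2 n :=
    mul_nonneg hε.le (Real.logb_nonneg one_lt_two (by exact_mod_cast NeZero.one_le))
  have hfloor := Nat.floor_le hpos
  have hbB' : (b : ℝ) ≤ B := by exact_mod_cast hbB
  refine ⟨φ, hφ, ?_, _, _, hp, ?_, alternating_alternatingList _ _, ?_⟩
  · rw [hp.quantifierNumber_eq]
    simp only [List.length_cons, List.length_append, List.length_replicate,
      length_alternatingList]
    push_cast
    linarith
  · push_cast
    linarith
  · rw [length_alternatingList]
    push_cast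
    linarith
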